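/- For a semigroup $S$, written multiplicatively, let $\mathcal P(S)$ denote the large power semigroup of $S$, that is, the semigroup of all non-empty subsets of $S$ under setwise multiplication $XY := \{xy : x \in X,\ y \in Y\}$. A semigroup $H$ is said to be globally isomorphic to a semigroup $K$ if there is a semigroup isomorphism $\mathcal P(H) \to \mathcal P(K)$. A numerical monoid is a submonoid of the additive monoid $(\mathbb N, +)$ of non-negative integers whose complement in $\mathbb N$ is finite; for such a monoid $H$, the operation of $\mathcal P(H)$ is the sumset operation $X + Y = \{x + y : x \in X,\ y \in Y\}$. Lemma. Let $H$ be a numerical monoid and let $K$ be a commutative monoid. If $H$ is globally isomorphic to $K$, then $K$ is cancellative; that is, for all $a, x, y \in K$, each of $ax = ay$ and $xa = ya$ implies $x = y$. -/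

import Mathlib

open scoped Pointwise

/-- The large power semigroup of `S`: the non-empty subsets of `S`, with setwise multiplication
`X * Y = {x * y | x ∈ X, y ∈ Y}`. -/
def LargePowerSemigroup (S : Type*) : Type _ := {X : Set S // X.Nonempty}

instance LargePowerSemigroup.instSemigroup (S : Type*) [Semigroup S] :
    Semigroup (LargePowerSemigroup S) where
  mul X Y := ⟨X.1 * Y.1, X.2.mul Y.2⟩
  mul_assoc X Y Z := Subtype.ext (mul_assoc X.1 Y.1 Z.1)

theorem LargePowerSemigroup.mem_mul {S : Type*} [Semigroup S] (X Y : LargePowerSemigroup S)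
    (z : S) : z ∈ (X * Y).1 ↔ ∃ x ∈ X.1, ∃ y ∈ Y.1, x * y = z :=
  Set.mem_mul

/-- `H` is globally isomorphic to `K` if there is a semigroup isomorphism between their large
power semigroups. -/
def GloballyIsomorphic (H K : Type*) [Semigroup H] [Semigroup K] : Prop :=
  Nonempty (LargePowerSemigroup H ≃* LargePowerSemigroup K)

/-- A numerical monoid is a submonoid of `(ℕ, +)` with finite complement in `ℕ`. -/
def IsNumericalMonoid (H : AddSubmonoid ℕ) : Prop :=
  ((H : Set ℕ)ᶜ).Finite

/-!
A global isomorphism transports submonoids, and the lattice of submonoids of a submonoid of `ℕ`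
is rigid enough to recover the powers of each element.

*From power semigroups to submonoids.* Submonoids are the idempotents of the power semigroup that
contain the identity, and for submonoids `S ≤ T` means `S * T = T`. In `H ⊆ ℕ` every idempotent
contains `0`, because its minimum `m` satisfies `m = 2m`. In `K` the only unit is `1`, so an
idempotent `X` absorbed by a submonoid contains `1`. Hence a global isomorphism gives an order
embedding `Φ : Submonoid K ↪o AddSubmonoid ℕ` whose range is a lower set
(`LargePowerSemigroup.exists_submonoid_orderEmbedding`). Only `Φ` and the absence of nontrivial
units are used afterwards.

*Powers in `K` are distinct.* An idempotent `e ≠ 1` would give a minimal nontrivial submonoid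
`{1, e}`, but `ℕ` has no minimal nontrivial submonoid. So `1` is the only idempotent, and
`x ^ i = x ^ j` with `x ≠ 1` forces `i = j` (`pow_right_injective_of_ne_one`).

*Generators correspond.* A submonoid `T` for which there is a greatest submonoid strictly below `T`
is cyclic, and under the previous point the converse holds as well. This order-theoretic
description makes `Φ` match cyclic submonoids: `Φ (powers x) = multiples (σ x)` for an injection
`σ : K → ℕ`, and `Φ T = σ '' T`.

*Rigidity.* For `x ≠ 1` one has `σ (x ^ k) = σ x * τ k`, where `τ` is a permutation of `ℕ` mapping
submonoids to submonoids. The least number of gaps of a submonoid of `ℕ` that avoids `k > 0` is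
`k / 2 + 1`, so `τ k / 2 ≤ k / 2`; as `τ` also respects divisibility, it is the identity
(`AddSubmonoid.eq_id_of_preserves_addSubmonoids`). Thus `σ (x ^ k) = σ x * k`.

*Cancellation.* By injectivity of `σ`, any `a`, `y` satisfy `y ^ σ a = a ^ σ y`. If `a * x = a * y`
then `a * x ^ k = a * y ^ k` for all `k`; taking `k = σ y` and replacing `x ^ σ y` by `y ^ σ x`
and a power of `a` by a power of `y` yields an equality between powers of `y`, from which
`σ x = σ y`, that is, `x = y`; here `y ≠ 1` is needed, and otherwise `x` takes its role
(`isCancelMul_of_submonoid_orderEmbedding`).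
-/

/-! ### Gaps of submonoids of the natural numbers -/

namespace AddSubmonoid

/-- A submonoid avoiding `k` misses `k - i` or `i` for each `i ≤ k / 2`; these gaps are distinct. -/
theorem half_lt_ncard_compl {S : AddSubmonoid ℕ} (hS : ((S : Set ℕ)ᶜ).Finite) {k : ℕ}
    (hk : k ∉ S) : k / 2 < ((S : Set ℕ)ᶜ).ncard := by
  classical
  have h : (Set.Iic (k / 2)).ncard ≤ ((S : Set ℕ)ᶜ).ncard := by
    refine Set.ncard_le_ncard_of_injOn (fun i => if i ∈ S then k - i else i) ?_ ?_ hS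
    · intro i hi
      have hi' : i ≤ k / 2 := hi
      by_cases hiS : i ∈ S
      · simp only [hiS, if_true, Set.mem_compl_iff, SetLike.mem_coe]
        intro h
        apply hk
        have := S.add_mem hiS h
        rwa [show i + (k - i) = k by omega] at this
      · simp [hiS]
    · intro i hi j hj hij
      have hi' : i ≤ k / 2 := hi
      have hj' : j ≤ k / 2 := hj
      dsimp only at hij
      split_ifs at hij <;> omega
  have h2 : (Set.Iic (k / 2)).ncard = k / 2 + 1 := by
    rw [← Finset.coe_Iic, Set.ncard_coe_finset, Nat.card_Iic]
  omega

/-- The submonoid `{0} ∪ {j | k / 2 < j, j ≠ k}`, where the inequality is in the rationals. For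
`k > 0` it has as few gaps as a submonoid avoiding `k` can have. -/
def upperHalfErase (k : ℕ) : AddSubmonoid ℕ where
  carrier := {j | j = 0 ∨ (k < 2 * j ∧ j ≠ k)}
  zero_mem' := Or.inl rfl
  add_mem' := by
    intro a b ha hb
    simp only [Set.mem_ofPred_eq] at *
    omega

theorem ncard_compl_upperHalfErase_le (k : ℕ) :
    ((upperHalfErase k : Set ℕ)ᶜ).Finite ∧ ((upperHalfErase k : Set ℕ)ᶜ).ncard ≤ k / 2 + 1 := by
  have hsub : ((upperHalfErase k : Set ℕ)ᶜ) ⊆ (insert k (Finset.Icc 1 (k / 2)) : Finset ℕ) := by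
    intro j hj
    have hj' : ¬ (j = 0 ∨ (k < 2 * j ∧ j ≠ k)) := hj
    simp only [Finset.coe_insert, Finset.coe_Icc, Set.mem_insert_iff, Set.mem_Icc]
    omega
  refine ⟨(Finset.finite_toSet _).subset hsub, ?_⟩
  refine (Set.ncard_le_ncard hsub (Finset.finite_toSet _)).trans ?_
  rw [Set.ncard_coe_finset]
  refine (Finset.card_insert_le _ _).trans ?_
  simp

/-- Compare the gaps of `upperHalfErase k` with those of its image, which avoids `τ k`. -/
theorem apply_half_le {τ : ℕ → ℕ} (hsurj : Function.Surjective τ) (h0 : τ 0 = 0)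
    (hτ : ∀ S : AddSubmonoid ℕ, ∃ S' : AddSubmonoid ℕ, ∀ k, τ k ∈ S' ↔ k ∈ S) (k : ℕ) :
    τ k / 2 ≤ k / 2 := by
  rcases Nat.eq_zero_or_pos k with rfl | hk
  · simp [h0]
  obtain ⟨S', hS'⟩ := hτ (upperHalfErase k)
  obtain ⟨hfin, hcard⟩ := ncard_compl_upperHalfErase_le k
  have hmem : τ k ∉ S' := by
    rw [hS']
    change ¬ (k = 0 ∨ (k < 2 * k ∧ k ≠ k))
    omega
  have hsub : ((S' : Set ℕ)ᶜ) ⊆ τ '' ((upperHalfErase k : Set ℕ)ᶜ) := by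
    intro n hn
    obtain ⟨j, rfl⟩ := hsurj n
    exact ⟨j, fun hj => hn ((hS' j).2 hj), rfl⟩
  have h1 := half_lt_ncard_compl ((hfin.image τ).subset hsub) hmem
  have h2 := Set.ncard_le_ncard hsub (hfin.image τ)
  have h3 := Set.ncard_image_le (f := τ) hfin
  omega

/-- Once the numbers below `2c` are fixed, `apply_half_le` leaves only the possibility that `τ`
exchanges `2c` and `2c + 1`; this is excluded by looking at `τ (4c)`. -/
theorem eq_id_of_preserves_addSubmonoids {τ : ℕ → ℕ} (hinj : Function.Injective τ)
    (hsurj : Function.Surjective τ) (h0 : τ 0 = 0)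
    (hτ : ∀ S : AddSubmonoid ℕ, ∃ S' : AddSubmonoid ℕ, ∀ k, τ k ∈ S' ↔ k ∈ S)
    (hdvd : ∀ k l, k ∣ l → τ k ∣ τ l) (k : ℕ) : τ k = k := by
  have hle := apply_half_le hsurj h0 hτ
  induction k using Nat.strong_induction_on with
  | _ k ih =>
  have hge : ∀ j, k ≤ j → k ≤ τ j := by
    intro j hj
    by_contra! hlt
    have := hinj (ih _ hlt)
    omega
  have hk1 := hge k le_rfl
  have hk2 := hle k
  by_contra hne
  -- `k ≤ τ k ≤ 2 (k / 2) + 1` and `τ k ≠ k`, so `k` is even.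
  obtain ⟨c, rfl⟩ : ∃ c, k = 2 * c := ⟨k / 2, by omega⟩
  have hτk : τ (2 * c) = 2 * c + 1 := by omega
  have hc : c ≠ 0 := by rintro rfl; simp [h0] at hne
  -- `τ (4c) ≤ 4c + 1` is a multiple of `2c + 1`, so it is `0 = τ 0` or `2c + 1 = τ (2c)`.
  obtain ⟨d, hd⟩ := hdvd (2 * c) (4 * c) ⟨2, by ring⟩
  rw [hτk] at hd
  have h4 := hle (4 * c)
  have hd2 : d < 2 := by
    by_contra! h2
    have : (2 * c + 1) * 2 ≤ (2 * c + 1) * d := Nat.mul_le_mul_left _ h2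
    omega
  interval_cases d
  · have := hinj (a₁ := 4 * c) (a₂ := 0) (by omega)
    omega
  · have := hinj (a₁ := 4 * c) (a₂ := 2 * c) (by omega)
    omega

end AddSubmonoid

/-! ### Cyclic submonoids from the order -/

section cyclic

variable {M : Type*} [Monoid M]

/-- Any element outside the greatest proper submonoid generates. -/
@[to_additive]
theorem Submonoid.exists_powers_eq_of_isGreatest_Iio {S T : Submonoid M}
    (h : IsGreatest (Set.Iio T) S) : ∃ x, Submonoid.powers x = T := by
  obtain ⟨x, hxT, hxS⟩ := SetLike.exists_of_lt (Set.mem_Iio.1 h.1)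
  refine ⟨x, eq_of_le_of_not_lt (Submonoid.powers_le.2 hxT) fun hlt => ?_⟩
  exact hxS (h.2 (Set.mem_Iio.2 hlt) (Submonoid.mem_powers x))

/-- The powers `x ^ n` with `n ≠ 1` form the greatest proper submonoid of `powers x`. -/
@[to_additive]
theorem Submonoid.exists_isGreatest_Iio_powers {x : M} (hx : ∀ n, x ^ n = x → n = 1) :
    ∃ S, IsGreatest (Set.Iio (Submonoid.powers x)) S := by
  refine ⟨⟨⟨{y | ∃ n, n ≠ 1 ∧ x ^ n = y}, ?_⟩, ⟨0, by simp⟩⟩, ?_, ?_⟩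
  · rintro _ _ ⟨m, hm, rfl⟩ ⟨n, hn, rfl⟩
    exact ⟨m + n, by omega, pow_add x m n⟩
  · refine Set.mem_Iio.2 (lt_of_le_of_ne ?_ ?_)
    · rintro _ ⟨n, _, rfl⟩
      exact ⟨n, rfl⟩
    · intro h
      obtain ⟨n, hn, hnx⟩ : x ∈ _ := h.symm ▸ Submonoid.mem_powers x
      exact hn (hx n hnx)
  · intro S hS y hy
    replace hS := Set.mem_Iio.1 hS
    obtain ⟨n, rfl⟩ := hS.le hy
    refine ⟨n, ?_, rfl⟩
    rintro rfl
    refine hS.not_ge (Submonoid.powers_le.2 ?_)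
    simpa using hy

end cyclic

theorem Submonoid.powers_eq_bot_iff {M : Type*} [Monoid M] {x : M} :
    Submonoid.powers x = ⊥ ↔ x = 1 := by
  rw [eq_bot_iff, Submonoid.powers_le, Submonoid.mem_bot]

/-! ### Order embeddings of the lattice of submonoids into that of the natural numbers -/

section lattice

variable {K : Type*} [CommMonoid K] {Φ : Submonoid K ↪o AddSubmonoid ℕ}

theorem map_bot_of_isLowerSet (hΦ : IsLowerSet (Set.range Φ)) : Φ ⊥ = ⊥ := by
  obtain ⟨T, hT⟩ := hΦ (bot_le : ⊥ ≤ Φ ⊥) ⟨⊥, rfl⟩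
  rw [eq_bot_iff, ← hT]
  exact Φ.monotone bot_le

theorem isGreatest_Iio_map_iff (hΦ : IsLowerSet (Set.range Φ)) {S T : Submonoid K} :
    IsGreatest (Set.Iio (Φ T)) (Φ S) ↔ IsGreatest (Set.Iio T) S := by
  constructor
  · rintro ⟨h1, h2⟩
    exact ⟨Φ.lt_iff_lt.1 h1, fun R hR => Φ.le_iff_le.1 (h2 (Φ.lt_iff_lt.2 hR))⟩
  · rintro ⟨h1, h2⟩
    refine ⟨Φ.lt_iff_lt.2 h1, fun A hA => ?_⟩
    obtain ⟨R, rfl⟩ := hΦ (le_of_lt hA) ⟨T, rfl⟩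
    exact Φ.le_iff_le.2 (h2 (Φ.lt_iff_lt.1 hA))

/-- An idempotent `e ≠ 1` would make `powers e = {1, e}` an atom, while no submonoid of `ℕ` is an
atom: below `A ∋ t ≠ 0` lies `multiples (2 * t)`. -/
theorem eq_one_of_mul_self_eq (hΦ : IsLowerSet (Set.range Φ)) {e : K} (he : e * e = e) :
    e = 1 := by
  by_contra hne
  have hpow : ∀ n, e ^ n = 1 ∨ e ^ n = e := by
    intro n
    induction n with
    | zero => simp
    | succ n ih =>
      right
      rcases ih with h | h <;> simp [pow_succ, h, he]
  have hbot : Φ (Submonoid.powers e) ≠ ⊥ := by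
    rw [← map_bot_of_isLowerSet hΦ, Φ.injective.ne_iff, Ne, Submonoid.powers_eq_bot_iff]
    exact hne
  obtain ⟨t, ht, ht0⟩ : ∃ t ∈ Φ (Submonoid.powers e), t ≠ 0 := by
    by_contra! h
    exact hbot (eq_bot_iff.2 h)
  have hle : AddSubmonoid.multiples (2 * t) ≤ Φ (Submonoid.powers e) := by
    rw [AddSubmonoid.multiples_le]
    simpa [two_mul] using add_mem ht ht
  obtain ⟨S, hS⟩ := hΦ hle ⟨_, rfl⟩
  have hSe : S ≤ Submonoid.powers e := Φ.le_iff_le.1 (hS.trans_le hle)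
  by_cases heS : e ∈ S
  · have : S = Submonoid.powers e := le_antisymm hSe (Submonoid.powers_le.2 heS)
    rw [← this, hS] at ht
    obtain ⟨n, hn⟩ := ht
    rcases n with _ | n
    · simp at hn; omega
    · simp only [smul_eq_mul] at hn
      have : 0 < t := Nat.pos_of_ne_zero ht0
      nlinarith
  · have : S = ⊥ := by
      rw [eq_bot_iff]
      intro y hy
      obtain ⟨n, rfl⟩ := hSe hy
      rcases hpow n with h | h
      · exact h
      · exact absurd (h ▸ hy) heS
    rw [this, map_bot_of_isLowerSet hΦ] at hS
    have h2 : 2 * t ∈ (⊥ : AddSubmonoid ℕ) := hS ▸ AddSubmonoid.mem_multiples _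
    rw [AddSubmonoid.mem_bot] at h2
    omega

/-- If `x ^ (i + d) = x ^ i` with `d > 0`, some positive power of `x` is idempotent, hence `1`, and `x`
is a unit. -/
theorem pow_right_injective_of_ne_one (hΦ : IsLowerSet (Set.range Φ))
    (hK : ∀ a b : K, a * b = 1 → a = 1) {x : K} (hx : x ≠ 1) :
    Function.Injective (fun n : ℕ => x ^ n) := by
  have hone : ∀ n, x ^ (n + 1) ≠ 1 := fun n h => hx (hK x (x ^ n) (by rw [← pow_succ', h]))
  have key : ∀ i d, x ^ (i + (d + 1)) ≠ x ^ i := by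
    intro i d h
    have hmul : ∀ l, x ^ (i + l * (d + 1)) = x ^ i := by
      intro l
      induction l with
      | zero => simp
      | succ l ih =>
        rw [show i + (l + 1) * (d + 1) = (i + (d + 1)) + l * (d + 1) by ring, pow_add, h,
          ← pow_add, ih]
    -- The exponent `(i + 1) (d + 1)` is a multiple of the period `d + 1` and exceeds the index `i`.
    have he : x ^ ((i + 1) * (d + 1)) * x ^ ((i + 1) * (d + 1)) = x ^ ((i + 1) * (d + 1)) := by
      have h1 : (i + 1) * (d + 1) = i + (i * d + d + 1) := by ring
      rw [← pow_add]
      conv_rhs => rw [h1, pow_add, ← hmul (i + 1), ← pow_add]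
      congr 1
      ring
    refine hone (i * d + i + d) ?_
    rw [show i * d + i + d + 1 = (i + 1) * (d + 1) by ring]
    exact eq_one_of_mul_self_eq hΦ he
  intro i j hij
  dsimp only at hij
  rcases lt_trichotomy i j with h | h | h
  · obtain ⟨d, rfl⟩ := Nat.exists_eq_add_of_lt h
    exact absurd hij.symm (key i d)
  · exact h
  · obtain ⟨d, rfl⟩ := Nat.exists_eq_add_of_lt h
    exact absurd hij (key j d)

theorem exists_map_powers_eq_multiples (hΦ : IsLowerSet (Set.range Φ))
    (hK : ∀ a b : K, a * b = 1 → a = 1) (x : K) :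
    ∃ n, Φ (Submonoid.powers x) = AddSubmonoid.multiples n := by
  rcases eq_or_ne x 1 with rfl | hx
  · exact ⟨0, by rw [Submonoid.powers_one, map_bot_of_isLowerSet hΦ,
      AddSubmonoid.multiples_zero]⟩
  · obtain ⟨S, hS⟩ := Submonoid.exists_isGreatest_Iio_powers (x := x) fun n hn =>
      pow_right_injective_of_ne_one hΦ hK hx (by simpa using hn)
    obtain ⟨n, hn⟩ := AddSubmonoid.exists_multiples_eq_of_isGreatest_Iio
      ((isGreatest_Iio_map_iff hΦ).2 hS)
    exact ⟨n, hn.symm⟩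

theorem exists_map_powers_eq_multiples_of_mem (hΦ : IsLowerSet (Set.range Φ))
    {T : Submonoid K} {n : ℕ} (hn : n ∈ Φ T) :
    ∃ x, Φ (Submonoid.powers x) = AddSubmonoid.multiples n := by
  obtain ⟨R, hR⟩ := hΦ (AddSubmonoid.multiples_le.2 hn) ⟨T, rfl⟩
  rcases Nat.eq_zero_or_pos n with rfl | hpos
  · exact ⟨1, by rw [Submonoid.powers_one, map_bot_of_isLowerSet hΦ,
      AddSubmonoid.multiples_zero]⟩
  · obtain ⟨A, hA⟩ := AddSubmonoid.exists_isGreatest_Iio_multiples (x := n) fun m hm => by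
      simpa [hpos.ne'] using hm
    rw [← hR] at hA
    obtain ⟨S, rfl⟩ := hΦ (le_of_lt hA.1) ⟨R, rfl⟩
    obtain ⟨x, rfl⟩ := Submonoid.exists_powers_eq_of_isGreatest_Iio
      ((isGreatest_Iio_map_iff hΦ).1 hA)
    exact ⟨x, hR⟩

theorem AddSubmonoid.multiples_injective_nat :
    Function.Injective (AddSubmonoid.multiples : ℕ → AddSubmonoid ℕ) := by
  intro m n h
  obtain ⟨i, hi⟩ := (h ▸ AddSubmonoid.mem_multiples m : m ∈ AddSubmonoid.multiples n)
  obtain ⟨j, hj⟩ := (h ▸ AddSubmonoid.mem_multiples n : n ∈ AddSubmonoid.multiples m)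
  exact Nat.dvd_antisymm (Dvd.intro_left j hj) (Dvd.intro_left i hi)

theorem powers_injective (hΦ : IsLowerSet (Set.range Φ)) (hK : ∀ a b : K, a * b = 1 → a = 1) :
    Function.Injective (Submonoid.powers : K → Submonoid K) := by
  intro x y h
  rcases eq_or_ne x 1 with rfl | hx
  · rw [Submonoid.powers_one] at h
    exact (Submonoid.powers_eq_bot_iff.1 h.symm).symm
  · obtain ⟨i, hi⟩ := (h ▸ Submonoid.mem_powers x : x ∈ Submonoid.powers y)
    obtain ⟨j, hj⟩ := (h ▸ Submonoid.mem_powers y : y ∈ Submonoid.powers x)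
    dsimp only at hi hj
    have hij : x ^ (j * i) = x ^ 1 := by rw [pow_mul, hj, hi, pow_one]
    have := pow_right_injective_of_ne_one hΦ hK hx hij
    rw [(mul_eq_one.1 this).2, pow_one] at hi
    exact hi.symm

/-- The map `σ` with `Φ (powers x) = multiples (σ x)` is injective and turns powers into products.
For fixed `x ≠ 1` the quotient `τ k = σ (x ^ k) / σ x` is a permutation of `ℕ` preserving
submonoids, and rigidity applies to it. -/
theorem exists_pow_additive_injection (hΦ : IsLowerSet (Set.range Φ))
    (hK : ∀ a b : K, a * b = 1 → a = 1) :
    ∃ σ : K → ℕ, Function.Injective σ ∧ ∀ x k, σ (x ^ k) = σ x * k := by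
  choose σ hσ using exists_map_powers_eq_multiples hΦ hK
  have hinj : Function.Injective σ := fun x y h => powers_injective hΦ hK
    (Φ.injective (by rw [hσ, hσ, h]))
  have hmem : ∀ T x, σ x ∈ Φ T ↔ x ∈ T := fun T x => by
    rw [← AddSubmonoid.multiples_le, ← hσ, Φ.le_iff_le, Submonoid.powers_le]
  have hex : ∀ T n, n ∈ Φ T → ∃ x, σ x = n := fun T n hn => by
    obtain ⟨x, hx⟩ := exists_map_powers_eq_multiples_of_mem hΦ hn
    exact ⟨x, AddSubmonoid.multiples_injective_nat (by rw [← hσ, hx])⟩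
  have hσ0 : ∀ x, σ x = 0 ↔ x = 1 := fun x => by
    rw [← AddSubmonoid.mem_bot, ← map_bot_of_isLowerSet hΦ, hmem, Submonoid.mem_bot]
  refine ⟨σ, hinj, fun x => ?_⟩
  rcases eq_or_ne x 1 with rfl | hx
  · simp [(hσ0 1).2 rfl]
  have hx0 : 0 < σ x := Nat.pos_of_ne_zero fun h => hx ((hσ0 x).1 h)
  have hpow := pow_right_injective_of_ne_one hΦ hK hx
  have hdvd : ∀ y k, σ y ∣ σ (y ^ k) := fun y k => by
    have : σ (y ^ k) ∈ AddSubmonoid.multiples (σ y) := by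
      rw [← hσ, hmem]
      exact ⟨k, rfl⟩
    obtain ⟨m, hm⟩ := this
    exact Dvd.intro_left m hm
  choose τ hτ using hdvd x
  have hτinj : Function.Injective τ := fun i j h => hpow (hinj (by dsimp only; rw [hτ, hτ, h]))
  have hτsurj : Function.Surjective τ := fun m => by
    have hm : σ x * m ∈ Φ (Submonoid.powers x) := by
      rw [hσ]
      exact ⟨m, by simp [mul_comm]⟩
    obtain ⟨z, hz⟩ := hex _ _ hm
    rw [← hz, hmem] at hm
    obtain ⟨k, rfl⟩ := hm
    exact ⟨k, Nat.eq_of_mul_eq_mul_left hx0 (by rw [← hτ]; exact hz)⟩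
  intro k
  rw [hτ]
  congr 1
  refine AddSubmonoid.eq_id_of_preserves_addSubmonoids hτinj hτsurj ?_ ?_ ?_ k
  · have := hτ 0
    rw [pow_zero, (hσ0 1).2 rfl] at this
    simpa [hx0.ne'] using this.symm
  · intro S
    -- `Φ T = {σ (x ^ k) | k ∈ S} = {σ x * τ k | k ∈ S}`; dividing by `σ x` gives `τ '' S`.
    let T : Submonoid K := (AddSubmonoid.toSubmonoid S).map (powersHom K x)
    refine ⟨(Φ T).comap (AddMonoidHom.mulLeft (σ x)), fun k => ?_⟩
    rw [AddSubmonoid.mem_comap, AddMonoidHom.coe_mulLeft, ← hτ, hmem, Submonoid.mem_map]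
    constructor
    · rintro ⟨j, hj, hjk⟩
      have : Multiplicative.toAdd j = k := hpow hjk
      exact this ▸ hj
    · intro hk
      exact ⟨Multiplicative.ofAdd k, hk, rfl⟩
  · rintro k _ ⟨m, rfl⟩
    have := hdvd (x ^ k) m
    rw [← pow_mul, hτ, hτ] at this
    exact Nat.dvd_of_mul_dvd_mul_left hx0 this

theorem isCancelMul_of_submonoid_orderEmbedding (hΦ : IsLowerSet (Set.range Φ))
    (hK : ∀ a b : K, a * b = 1 → a = 1) : IsCancelMul K := by
  obtain ⟨σ, hinj, hσ⟩ := exists_pow_additive_injection hΦ hK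
  have hcomm : ∀ x y, x ^ σ y = y ^ σ x := fun x y => hinj (by rw [hσ, hσ, mul_comm])
  have main : ∀ a x y : K, y ≠ 1 → a * x = a * y → x = y := by
    intro a x y hy h
    have hpow : ∀ k, a * x ^ k = a * y ^ k := by
      intro k
      induction k with
      | zero => simp
      | succ k ih =>
        rw [pow_succ', ← mul_assoc, h, mul_right_comm, ih, mul_right_comm, mul_assoc,
          ← pow_succ']
    have h1 : a * y ^ σ x = a * y ^ σ y := by rw [← hcomm, hpow]
    have h2 : a ^ σ y * y ^ σ x = a ^ σ y * y ^ σ y := by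
      have hy0 : σ y ≠ 0 := fun h0 => by
        have := hσ y 2
        rw [h0, zero_mul, ← h0] at this
        have := pow_right_injective_of_ne_one hΦ hK hy (a₁ := 2) (a₂ := 1)
          (by simpa using hinj this)
        omega
      obtain ⟨n, hn⟩ := Nat.exists_eq_succ_of_ne_zero hy0
      rw [show a ^ σ y = a ^ n * a by rw [hn, pow_succ], mul_assoc, h1, mul_assoc]
    -- `a ^ σ y` is itself the power `y ^ σ a`, so `h2` compares two powers of `y`.
    rw [hcomm a y, ← pow_add, ← pow_add] at h2
    have := pow_right_injective_of_ne_one hΦ hK hy h2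
    exact hinj (Nat.add_left_cancel this)
  have : IsLeftCancelMul K := ⟨fun a x y h => by
    rcases eq_or_ne y 1 with rfl | hy
    · by_contra hx
      exact hx (main a 1 x hx h.symm).symm
    · exact main a x y hy h⟩
  exact CommMagma.IsLeftCancelMul.toIsCancelMul K

end lattice

/-! ### Global isomorphisms and submonoids -/

namespace LargePowerSemigroup

theorem val_mul {S : Type*} [Semigroup S] (X Y : LargePowerSemigroup S) :
    (X * Y).1 = X.1 * Y.1 := rfl

variable {K M : Type*} [CommMonoid K] [CommMonoid M]

/-- An element, as a one-element subset. -/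
def single (a : K) : LargePowerSemigroup K := ⟨{a}, Set.singleton_nonempty a⟩

theorem single_mul_single (a b : K) : single a * single b = single (a * b) :=
  Subtype.ext Set.singleton_mul_singleton

/-- A submonoid, as an element of the large power semigroup. -/
def ofSubmonoid (T : Submonoid K) : LargePowerSemigroup K := ⟨T, 1, T.one_mem⟩

theorem ofSubmonoid_mul_eq_right_iff {S T : Submonoid K} :
    ofSubmonoid S * ofSubmonoid T = ofSubmonoid T ↔ S ≤ T := by
  refine Subtype.ext_iff.trans ?_
  change (S : Set K) * (T : Set K) = T ↔ _
  constructor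
  · intro h x hx
    have : x * 1 ∈ (S : Set K) * (T : Set K) := Set.mul_mem_mul hx T.one_mem
    rw [h, mul_one] at this
    exact this
  · intro h
    refine subset_antisymm ?_ fun x hx => ⟨1, S.one_mem, x, hx, one_mul x⟩
    rintro _ ⟨a, ha, b, hb, rfl⟩
    exact T.mul_mem (h ha) hb

theorem ofSubmonoid_bot_mul (X : LargePowerSemigroup K) : ofSubmonoid ⊥ * X = X :=
  Subtype.ext (one_mul X.1)

theorem mul_ofSubmonoid_bot (X : LargePowerSemigroup K) : X * ofSubmonoid ⊥ = X :=
  Subtype.ext (mul_one X.1)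

theorem exists_ofSubmonoid_eq {X : LargePowerSemigroup K} (hX : X * X = X) (h1 : 1 ∈ X.1) :
    ∃ T, ofSubmonoid T = X := by
  refine ⟨⟨⟨X.1, fun {a b} ha hb => ?_⟩, h1⟩, rfl⟩
  rw [← hX]
  exact Set.mul_mem_mul ha hb

/-- Having no nontrivial units passes to globally isomorphic monoids. -/
theorem eq_one_of_mul_eq_one (g : LargePowerSemigroup K ≃* LargePowerSemigroup M)
    (hM : ∀ a b : M, a * b = 1 → a = 1) (a b : K) (hab : a * b = 1) : a = 1 := by
  have hg1 : g (ofSubmonoid ⊥) = ofSubmonoid ⊥ := by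
    obtain ⟨Y, hY⟩ := g.surjective (ofSubmonoid ⊥)
    have h : g (ofSubmonoid ⊥) * ofSubmonoid ⊥ = ofSubmonoid ⊥ := by
      rw [← hY, ← map_mul, ofSubmonoid_bot_mul]
    exact (mul_ofSubmonoid_bot _).symm.trans h
  have hmul : g (single a) * g (single b)
      = ofSubmonoid ⊥ := by
    rw [← map_mul, single_mul_single, hab]
    exact hg1
  have ha : g (single a) = g (ofSubmonoid ⊥) := by
    rw [hg1]
    obtain ⟨z, hz⟩ := (g (single b)).2
    refine Subtype.ext ((Set.eq_singleton_iff_nonempty_unique_mem).2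
      ⟨(g (single a)).2, fun y hy => hM y z ?_⟩)
    have := Set.mul_mem_mul hy hz
    rw [← val_mul, hmul] at this
    exact this
  have := congrArg Subtype.val (g.injective ha)
  exact Set.singleton_injective this

/-- A global isomorphism restricts to submonoids. The hypothesis `hM` ensures that images of
submonoids of `K` contain `1`. Conversely, the preimage `X` of a submonoid lying below the image of
`T` satisfies `X * T = T ∋ 1`, so it contains a divisor of `1`, which is `1` by `hK`. -/
theorem exists_submonoid_orderEmbedding (g : LargePowerSemigroup K ≃* LargePowerSemigroup M)
    (hM : ∀ X : LargePowerSemigroup M, X * X = X → 1 ∈ X.1)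
    (hK : ∀ a b : K, a * b = 1 → a = 1) :
    ∃ Φ : Submonoid K ↪o Submonoid M, IsLowerSet (Set.range Φ) := by
  have hex : ∀ T : Submonoid K, ∃ S : Submonoid M, ofSubmonoid S = g (ofSubmonoid T) := by
    intro T
    have h : g (ofSubmonoid T) * g (ofSubmonoid T) = g (ofSubmonoid T) := by
      rw [← map_mul, ofSubmonoid_mul_eq_right_iff.2 le_rfl]
    exact exists_ofSubmonoid_eq h (hM _ h)
  choose Φ hΦ using hex
  have hle : ∀ S T, Φ S ≤ Φ T ↔ S ≤ T := fun S T => by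
    rw [← ofSubmonoid_mul_eq_right_iff, hΦ, hΦ, ← map_mul, g.injective.eq_iff,
      ofSubmonoid_mul_eq_right_iff]
  refine ⟨OrderEmbedding.ofMapLEIff Φ hle, ?_⟩
  rintro _ A hA ⟨T, rfl⟩
  replace hA : A ≤ Φ T := hA
  set X := g.symm (ofSubmonoid A) with hX
  have hXX : X * X = X := by rw [hX, ← map_mul, ofSubmonoid_mul_eq_right_iff.2 le_rfl]
  have hXT : X * ofSubmonoid T = ofSubmonoid T := by
    apply g.injective
    rw [map_mul, hX, g.apply_symm_apply, ← hΦ, ofSubmonoid_mul_eq_right_iff.2 hA]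
  have h1 : (1 : K) ∈ X.1 := by
    have h : (1 : K) ∈ (X * ofSubmonoid T).1 := by
      rw [hXT]
      exact T.one_mem
    obtain ⟨x, hx, t, -, hxt⟩ := h
    rwa [← hK x t hxt]
  obtain ⟨S, hS⟩ := exists_ofSubmonoid_eq hXX h1
  refine ⟨S, ?_⟩
  have : ofSubmonoid (Φ S) = ofSubmonoid A := by rw [hΦ, hS, hX, g.apply_symm_apply]
  exact SetLike.coe_injective (congrArg Subtype.val this)

end LargePowerSemigroup

/-! ### The power semigroup of a submonoid of `ℕ` -/

/-- The least element of an idempotent set of natural numbers is `0`. -/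
theorem one_mem_of_mul_self_eq {H : AddSubmonoid ℕ}
    {X : LargePowerSemigroup (Multiplicative H)} (hX : X * X = X) : 1 ∈ X.1 := by
  obtain ⟨m, hm, hmin⟩ := WellFounded.has_min
    (InvImage.wf (fun z : Multiplicative H => (z.toAdd : ℕ)) wellFounded_lt) X.1 X.2
  rw [← hX] at hm
  obtain ⟨a, ha, b, hb, rfl⟩ := hm
  have h1 : ¬ ((a.toAdd : ℕ) < (a * b).toAdd) := hmin a ha
  have hb0 : (b.toAdd : ℕ) = 0 := by
    simp only [toAdd_mul, AddSubmonoid.coe_add] at h1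
    omega
  have : b = 1 := Multiplicative.toAdd.injective (Subtype.ext hb0)
  exact this ▸ hb

theorem multiplicative_eq_one_of_mul_eq_one {H : AddSubmonoid ℕ} (a b : Multiplicative H)
    (hab : a * b = 1) : a = 1 := by
  have h : (a.toAdd : ℕ) + b.toAdd = 0 := congrArg (fun z : Multiplicative H => (z.toAdd : ℕ)) hab
  exact Multiplicative.toAdd.injective (Subtype.ext (by simpa using (Nat.add_eq_zero_iff.1 h).1))

theorem exists_orderEmbedding_addSubmonoid_nat (H : AddSubmonoid ℕ) :
    ∃ Φ : Submonoid (Multiplicative H) ↪o AddSubmonoid ℕ, Set.range Φ = Set.Iic H := by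
  refine ⟨OrderEmbedding.ofMapLEIff (fun T => (Submonoid.toAddSubmonoid' T).map H.subtype)
    fun S T => ?_, Set.ext fun A => ⟨?_, fun hA => ?_⟩⟩
  · rw [AddSubmonoid.map_le_map_iff_of_injective H.subtype_injective,
      Submonoid.toAddSubmonoid'.le_iff_le]
  · rintro ⟨T, rfl⟩
    rintro _ ⟨n, -, rfl⟩
    exact n.2
  · refine ⟨AddSubmonoid.toSubmonoid (A.comap H.subtype), ?_⟩
    exact AddSubmonoid.map_comap_eq_self (by rwa [AddSubmonoid.mrange_subtype])

theorem mainTheorem5 (H : AddSubmonoid ℕ) (hH : IsNumericalMonoid H)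
    (K : Type*) [CommMonoid K] (hHK : GloballyIsomorphic (Multiplicative H) K) :
    IsCancelMul K := by
  obtain ⟨f⟩ := hHK
  have hK := LargePowerSemigroup.eq_one_of_mul_eq_one f.symm multiplicative_eq_one_of_mul_eq_one
  obtain ⟨Φ, hΦ⟩ := LargePowerSemigroup.exists_submonoid_orderEmbedding f.symm
    (fun X => one_mem_of_mul_self_eq) hK
  obtain ⟨Ψ, hΨ⟩ := exists_orderEmbedding_addSubmonoid_nat H
  refine isCancelMul_of_submonoid_orderEmbedding (Φ := Φ.trans Ψ) ?_ hK
  rintro _ A hA ⟨T, rfl⟩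
  obtain ⟨B, rfl⟩ : A ∈ Set.range Ψ := by
    rw [hΨ]
    exact le_trans hA (hΨ ▸ Set.mem_range_self (Φ T) : Ψ (Φ T) ∈ Set.Iic H)
  obtain ⟨S, rfl⟩ := hΦ (Ψ.le_iff_le.1 hA) ⟨T, rfl⟩
  exact ⟨S, rfl⟩
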